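/- For an integer $n\ge 1$ and a real number $\varphi$, let $M(n,\varphi)$ denote the largest cardinality of a subset $X$ of the unit sphere $\mathbf{S}^{n-1}$ of the Euclidean space $\mathbf{R}^n$ such that $\langle x,y\rangle\le\cos\varphi$ for all $x\ne y$ in $X$. **Theorem (Polynomial Kabatjanskii–Levenshtein).** Let $\gamma>0$ be a fixed real number. Let $n\ge 4$ be an integer with $n\ge 2\gamma\lceil(\gamma+1)^2\rceil$, and let $\varphi$ be such that $$\cos\varphi\le\frac{\gamma}{\sqrt n}.$$ Then $M(n,\varphi)$ is finite and $$M(n,\varphi)\le\frac{(n-1)^{\gamma^2+2\gamma+3}}{\Gamma(\gamma^2+2\gamma+2)}.$$ -/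

import Mathlib

/-- `X` is a spherical code with angular separation `φ` on the unit sphere of the Euclidean
space `ℝⁿ`: its points are unit vectors, and any two distinct ones have inner product
at most `cos φ`. The set `X` is not assumed to be finite. -/
def IsSphericalCode (n : ℕ) (φ : ℝ) (X : Set (EuclideanSpace ℝ (Fin n))) : Prop :=
  X ⊆ Metric.sphere (0 : EuclideanSpace ℝ (Fin n)) 1 ∧
    ∀ x ∈ X, ∀ y ∈ X, x ≠ y → inner ℝ x y ≤ Real.cos φ

/-- The largest cardinality `M(n, φ)` of a spherical code with angular separation `φ` on the
unit sphere of `ℝⁿ`, as an extended natural number (`⊤` if there are arbitrarily large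
codes). A finite value is the cardinality of some code, since a bounded nonempty set of
natural numbers has a maximum. -/
noncomputable def maxSphericalCode (n : ℕ) (φ : ℝ) : ℕ∞ :=
  sSup {m : ℕ∞ | ∃ X : Set (EuclideanSpace ℝ (Fin n)), IsSphericalCode n φ X ∧ X.encard = m}

/-!
The proof is Delsarte's linear programming method with a test polynomial of
Kabatjanskii–Levenshtein type, arranged so that no integration over the sphere is needed.

Write `n = d + 2` and let `P k` be the Gegenbauer polynomials of dimension `n` with `P k 1 = 1`,
given by `t * P k = a k * P (k + 1) + b k * P (k - 1)`, where `a k = (k + d) / (2 * k + d)` and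
`b k = k / (2 * k + d)`. They are positive definite on the sphere
(`posSemidef_gegenbauer`): `P k ⟪x, y⟫` is the value at `x` of a harmonic form `zonal y k`, and
taking the Fischer product of a harmonic form with `zonal x k` evaluates that form at `x`, up to
a positive constant (`exists_fischer_zonal`), so the matrices in question are Gram matrices.

Take `F = b j * P (j - 1) + l * P j + a j * P (j + 1)`.
If `l ^ 2 = b j * a (j - 1) + a j * b (j + 1)`, then `(b j, l, a j)` is an eigenvector for the eigenvalue `l` of the recurrence restricted to
these three degrees, and `t * F - l * F` is a nonnegative combination of `P (j - 2)` and
`P (j + 2)` (`mul_klPoly`). By the Schur product theorem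
`∑ (⟪x, y⟫ - s) * F ⟪x, y⟫ ^ 2 ≥ (l - s) * ∑ F ⟪x, y⟫ ^ 2`, the sums being over pairs of points of
the code. If distinct points have inner product at most `s`, the left side is at most its
diagonal part `N * (1 - s) * F 1 ^ 2`, where `N` is the size of the code. On the other hand the
matrix `F ⟪x, y⟫` has rank at most `D`, the number of monomials of degrees `j` and `j + 1` in `n`
variables, so the trace inequality `trace_sq_le_rank_mul` gives
`∑ F ⟪x, y⟫ ^ 2 ≥ N ^ 2 * F 1 ^ 2 / D`. Hence `N * (l - s) ≤ (1 - s) * D` (`card_mul_le_of_code`).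

For the stated bound put `s = γ / √n` and `p = ⌊(γ + 1) ^ 2⌋`. Since the logarithm of the Gamma
function is convex, the right side is at least `(n - 1) ^ (p + 2) / p!`. For `p ≥ 4` the choice
`j = p / 2` makes `√n * l ≥ γ + 1 / 5` (`le_mul_recurrence_coeff`) and
`5 * √n * D ≤ (n - 1) ^ (p + 2) / p!` (`choose_add_choose_mul_sqrt_le`); the values `p ≤ 3` are
settled with `j = 0` or `j = 1`.
-/

open MvPolynomial Finset

/-! ### The Laplacian and directional derivatives of polynomials -/

/-- The linear form `x ↦ ⟪x, y⟫`. -/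
noncomputable def linForm {n : ℕ} (y : Fin n → ℝ) : MvPolynomial (Fin n) ℝ :=
  ∑ i, C (y i) * X i

/-- The quadratic form `x ↦ ‖x‖ ^ 2` in `n` variables. -/
noncomputable def normSq (n : ℕ) : MvPolynomial (Fin n) ℝ := ∑ i, X i ^ 2

/-- The Laplacian of a real polynomial in `n` variables. -/
noncomputable def laplacian {n : ℕ} (p : MvPolynomial (Fin n) ℝ) : MvPolynomial (Fin n) ℝ :=
  ∑ i, pderiv i (pderiv i p)

/-- The derivative of a polynomial in the direction of the vector `y`. -/
noncomputable def dirDeriv {n : ℕ} (y : Fin n → ℝ) (p : MvPolynomial (Fin n) ℝ) :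
    MvPolynomial (Fin n) ℝ := ∑ i, C (y i) * pderiv i p

section Calculus

variable {n : ℕ}

lemma pderiv_linForm (y : Fin n → ℝ) (i : Fin n) : pderiv i (linForm y) = C (y i) := by
  rw [linForm, map_sum]
  simp [pderiv_X, Pi.single_apply]

lemma pderiv_normSq (i : Fin n) : pderiv i (normSq n) = 2 * X i := by
  rw [normSq, map_sum]
  simp [pderiv_X, Pi.single_apply]

lemma laplacian_sub (p q : MvPolynomial (Fin n) ℝ) :
    laplacian (p - q) = laplacian p - laplacian q := by
  simp [laplacian, sum_sub_distrib]

lemma laplacian_C_mul (a : ℝ) (p : MvPolynomial (Fin n) ℝ) :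
    laplacian (C a * p) = C a * laplacian p := by
  simp [laplacian, mul_sum]

lemma laplacian_linForm_mul (y : Fin n → ℝ) (p : MvPolynomial (Fin n) ℝ) :
    laplacian (linForm y * p) = linForm y * laplacian p + 2 * dirDeriv y p := by
  simp only [laplacian, dirDeriv, mul_sum, ← sum_add_distrib]
  refine sum_congr rfl fun i _ => ?_
  simp only [pderiv_mul, pderiv_linForm, map_add, pderiv_C]
  ring

lemma laplacian_normSq_mul {k : ℕ} {p : MvPolynomial (Fin n) ℝ} (hp : p.IsHomogeneous k) :
    laplacian (normSq n * p) = normSq n * laplacian p + (2 * n + 4 * k : ℕ) * p := by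
  have h : laplacian (normSq n * p) =
      ∑ i, (normSq n * pderiv i (pderiv i p) + 2 * p + 4 * (X i * pderiv i p)) := by
    refine sum_congr rfl fun i _ => ?_
    simp only [pderiv_mul, pderiv_normSq, map_add, pderiv_X_self]
    have : pderiv i (2 : MvPolynomial (Fin n) ℝ) = 0 := by
      exact_mod_cast (pderiv i).map_natCast 2
    rw [this]; ring
  rw [h, sum_add_distrib, sum_add_distrib, ← mul_sum, ← mul_sum, ← mul_sum, hp.sum_X_mul_pderiv]
  simp [laplacian]
  ring

lemma dirDeriv_mul (y : Fin n → ℝ) (p q : MvPolynomial (Fin n) ℝ) :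
    dirDeriv y (p * q) = dirDeriv y p * q + p * dirDeriv y q := by
  simp only [dirDeriv, mul_sum, sum_mul, ← sum_add_distrib]
  refine sum_congr rfl fun i _ => ?_
  rw [pderiv_mul]; ring

lemma dirDeriv_sub (y : Fin n → ℝ) (p q : MvPolynomial (Fin n) ℝ) :
    dirDeriv y (p - q) = dirDeriv y p - dirDeriv y q := by
  simp [dirDeriv, mul_sub, sum_sub_distrib]

lemma dirDeriv_C (y : Fin n → ℝ) (a : ℝ) : dirDeriv y (C a) = 0 := by
  simp [dirDeriv]

lemma dirDeriv_linForm {y : Fin n → ℝ} (hy : ∑ i, y i ^ 2 = 1) :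
    dirDeriv y (linForm y) = 1 := by
  simp only [dirDeriv, pderiv_linForm, ← sq]
  simp only [← C_pow]
  rw [← map_sum, hy, map_one]

lemma dirDeriv_normSq (y : Fin n → ℝ) : dirDeriv y (normSq n) = 2 * linForm y := by
  simp only [dirDeriv, pderiv_normSq, linForm, mul_sum]
  exact sum_congr rfl fun i _ => by ring

lemma pderiv_comm (i j : Fin n) (p : MvPolynomial (Fin n) ℝ) :
    pderiv i (pderiv j p) = pderiv j (pderiv i p) := by
  ext m
  simp only [coeff_pderiv]
  rcases eq_or_ne i j with rfl | h
  · rfl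
  · rw [add_right_comm]
    simp [Finsupp.single_eq_of_ne h, Finsupp.single_eq_of_ne h.symm]
    ring

lemma laplacian_dirDeriv (y : Fin n → ℝ) (p : MvPolynomial (Fin n) ℝ) :
    laplacian (dirDeriv y p) = dirDeriv y (laplacian p) := by
  simp only [laplacian, dirDeriv, map_sum, pderiv_C_mul, mul_sum]
  rw [sum_comm]
  refine sum_congr rfl fun i _ => sum_congr rfl fun j _ => ?_
  rw [pderiv_comm j i, pderiv_comm j i]

lemma isHomogeneous_linForm (y : Fin n → ℝ) : (linForm y).IsHomogeneous 1 :=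
  IsHomogeneous.sum _ _ _ fun i _ => by
    simpa using (isHomogeneous_C _ (y i)).mul (isHomogeneous_X ℝ i)

lemma isHomogeneous_normSq : (normSq n).IsHomogeneous 2 :=
  IsHomogeneous.sum _ _ _ fun i _ => isHomogeneous_X_pow i 2

lemma eval_linForm (x y : Fin n → ℝ) : eval x (linForm y) = x ⬝ᵥ y := by
  simp [linForm, dotProduct, mul_comm]

lemma eval_normSq (x : Fin n → ℝ) : eval x (normSq n) = ∑ i, x i ^ 2 := by
  simp [normSq]

lemma isHomogeneous_dirDeriv (y : Fin n → ℝ) {k : ℕ} {p : MvPolynomial (Fin n) ℝ}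
    (hp : p.IsHomogeneous (k + 1)) : (dirDeriv y p).IsHomogeneous k :=
  IsHomogeneous.sum _ _ _ fun i _ => by
    simpa using (isHomogeneous_C _ (y i)).mul (hp.pderiv (i := i))

/-- Euler's identity, evaluated at `x`. -/
lemma eval_dirDeriv_self (x : Fin n → ℝ) {k : ℕ} {p : MvPolynomial (Fin n) ℝ}
    (hp : p.IsHomogeneous k) : eval x (dirDeriv x p) = k * eval x p := by
  have := congrArg (eval x) hp.sum_X_mul_pderiv
  simpa [dirDeriv] using this

end Calculus

/-! ### The Fischer product -/

/-- The Fischer product `⟨q, p⟩ = ∑ m, m! * q m * p m` of real polynomials, as a linear form in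
the second argument; monomials are orthogonal and multiplication by a variable is adjoint to the
partial derivative. -/
noncomputable def fischer {n : ℕ} (q : MvPolynomial (Fin n) ℝ) : MvPolynomial (Fin n) ℝ →ₗ[ℝ] ℝ :=
  (basisMonomials (Fin n) ℝ).constr ℝ fun m => coeff m q * ∏ i, ((m i).factorial : ℝ)

section Fischer
variable {n : ℕ}

lemma fischer_monomial (q : MvPolynomial (Fin n) ℝ) (m : Fin n →₀ ℕ) (a : ℝ) :
    fischer q (monomial m a) = a * (coeff m q * ∏ i, ((m i).factorial : ℝ)) := by
  have : monomial m a = a • basisMonomials (Fin n) ℝ m := by simp [smul_monomial]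
  rw [this, map_smul, fischer, Module.Basis.constr_basis, smul_eq_mul]

lemma fischer_self_nonneg (q : MvPolynomial (Fin n) ℝ) : 0 ≤ fischer q q := by
  have h : fischer q q = ∑ m ∈ q.support, fischer q (monomial m (coeff m q)) := by
    rw [← map_sum, ← q.as_sum]
  rw [h]
  simp only [fischer_monomial, ← mul_assoc]
  refine sum_nonneg fun m _ => mul_nonneg (mul_self_nonneg _) ?_
  positivity

/-- Multiplication by a variable is adjoint to the partial derivative. -/
lemma fischer_X_mul (i : Fin n) (p q : MvPolynomial (Fin n) ℝ) :
    fischer q (X i * p) = fischer (pderiv i q) p := by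
  induction p using MvPolynomial.induction_on' with
  | add p q hp hq => rw [mul_add, map_add, map_add, hp, hq]
  | monomial m a =>
    rw [X, monomial_mul, one_mul, fischer_monomial, fischer_monomial, coeff_pderiv,
      add_comm (Finsupp.single i 1) m]
    have h : ∏ j, ((((m + Finsupp.single i 1 : Fin n →₀ ℕ) j).factorial : ℕ) : ℝ) =
        (m i + 1) * ∏ j, ((m j).factorial : ℝ) := by
      rw [← mul_prod_erase univ _ (mem_univ i),
        ← mul_prod_erase univ (fun j => ((m j).factorial : ℝ)) (mem_univ i), ← mul_assoc]
      congr 1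
      · simp [Nat.factorial_succ]
      · refine prod_congr rfl fun j hj => ?_
        simp [Finsupp.single_eq_of_ne (ne_of_mem_erase hj)]
    rw [h]; ring

lemma fischer_C_mul (a : ℝ) (p q : MvPolynomial (Fin n) ℝ) :
    fischer q (C a * p) = a * fischer q p := by
  rw [C_mul', map_smul, smul_eq_mul]

lemma fischer_add_left (p q r : MvPolynomial (Fin n) ℝ) :
    fischer (p + q) r = fischer p r + fischer q r := by
  induction r using MvPolynomial.induction_on' with
  | add r s hr hs => simp only [map_add, hr, hs]; ring
  | monomial m a => simp only [fischer_monomial, coeff_add]; ring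

lemma fischer_C_mul_left (a : ℝ) (p r : MvPolynomial (Fin n) ℝ) :
    fischer (C a * p) r = a * fischer p r := by
  induction r using MvPolynomial.induction_on' with
  | add r s hr hs => simp only [map_add, hr, hs]; ring
  | monomial m b => simp only [fischer_monomial, coeff_C_mul]; ring

lemma fischer_sum_left {ι : Type*} (s : Finset ι) (f : ι → MvPolynomial (Fin n) ℝ)
    (r : MvPolynomial (Fin n) ℝ) : fischer (∑ i ∈ s, f i) r = ∑ i ∈ s, fischer (f i) r := by
  classical
  induction s using Finset.induction_on with
  | empty => simpa using fischer_C_mul_left 0 0 r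
  | insert a s ha ih => rw [sum_insert ha, sum_insert ha, fischer_add_left, ih]

lemma fischer_linForm_mul (y : Fin n → ℝ) (p q : MvPolynomial (Fin n) ℝ) :
    fischer q (linForm y * p) = fischer (dirDeriv y q) p := by
  simp only [linForm, dirDeriv, sum_mul, mul_assoc, map_sum, fischer_C_mul, fischer_X_mul,
    fischer_sum_left, fischer_C_mul_left]

lemma fischer_normSq_mul (p q : MvPolynomial (Fin n) ℝ) :
    fischer q (normSq n * p) = fischer (laplacian q) p := by
  simp only [normSq, laplacian, sum_mul, sq, mul_assoc, map_sum, fischer_X_mul, fischer_sum_left]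

end Fischer

/-! ### Zonal harmonics and Gegenbauer polynomials -/

/-- The zonal form of degree `k` with pole `y` in `d + 2` variables, for a unit vector `y`: the
homogenization of `gegenbauer d k ⟪x, y⟫` by powers of `‖x‖ ^ 2`. -/
noncomputable def zonal {d : ℕ} (y : Fin (d + 2) → ℝ) : ℕ → MvPolynomial (Fin (d + 2)) ℝ
  | 0 => 1
  | 1 => linForm y
  | k + 2 => C ((2 * k + 2 + d) / (k + 1 + d) : ℝ) * (linForm y * zonal y (k + 1)) -
      C ((k + 1) / (k + 1 + d) : ℝ) * (normSq (d + 2) * zonal y k)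

/-- The Gegenbauer polynomial of degree `k` that is orthogonal for the sphere in dimension
`d + 2`, normalized to take the value `1` at `1`. -/
noncomputable def gegenbauer (d : ℕ) : ℕ → ℝ → ℝ
  | 0, _ => 1
  | 1, t => t
  | k + 2, t => (2 * k + 2 + d) / (k + 1 + d) * (t * gegenbauer d (k + 1) t) -
      (k + 1) / (k + 1 + d) * gegenbauer d k t

section Zonal
variable {d : ℕ}

lemma eval_zonal {x : Fin (d + 2) → ℝ} (hx : ∑ i, x i ^ 2 = 1) (y : Fin (d + 2) → ℝ) (k : ℕ) :
    eval x (zonal y k) = gegenbauer d k (x ⬝ᵥ y) := by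
  induction k using Nat.twoStepInduction with
  | zero => simp [zonal, gegenbauer]
  | one => simp [zonal, gegenbauer, eval_linForm]
  | more k h0 h1 => simp [zonal, gegenbauer, eval_linForm, eval_normSq, hx, h0, h1]

lemma gegenbauer_one (k : ℕ) : gegenbauer d k 1 = 1 := by
  induction k using Nat.twoStepInduction with
  | zero => simp [gegenbauer]
  | one => simp [gegenbauer]
  | more k h0 h1 =>
    rw [gegenbauer, h0, h1]
    field_simp
    ring

/-- The three-term recurrence. At `k = 0` the second coefficient vanishes, so that the truncated
subtraction `k - 1` is harmless. -/
lemma gegenbauer_rec (hd : 0 < d) (k : ℕ) (t : ℝ) :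
    t * gegenbauer d k t = (k + d) / (2 * k + d) * gegenbauer d (k + 1) t +
      k / (2 * k + d) * gegenbauer d (k - 1) t := by
  have : (0 : ℝ) < d := by exact_mod_cast hd
  cases k with
  | zero => simp [gegenbauer]; field_simp
  | succ k =>
    simp only [gegenbauer, Nat.add_sub_cancel]
    push_cast
    field_simp
    ring

lemma isHomogeneous_zonal (y : Fin (d + 2) → ℝ) (k : ℕ) : (zonal y k).IsHomogeneous k := by
  induction k using Nat.twoStepInduction with
  | zero => exact isHomogeneous_one _ _
  | one => exact isHomogeneous_linForm y
  | more k h0 h1 =>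
    rw [zonal]
    refine IsHomogeneous.sub ?_ ?_
    · simpa [add_comm, add_left_comm, add_assoc] using
        (isHomogeneous_C _ _).mul ((isHomogeneous_linForm y).mul h1)
    · simpa [add_comm, add_left_comm, add_assoc] using
        (isHomogeneous_C _ _).mul (isHomogeneous_normSq.mul h0)

/-- The homogenized recurrence, with denominators cleared. The term with `k - 1` vanishes for
`k = 0`. -/
lemma zonal_rec (hd : 0 < d) (y : Fin (d + 2) → ℝ) (k : ℕ) :
    ((k + d : ℕ) : MvPolynomial (Fin (d + 2)) ℝ) * zonal y (k + 1) =
      (2 * k + d : ℕ) * (linForm y * zonal y k) - k * (normSq (d + 2) * zonal y (k - 1)) := by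
  have : (0 : ℝ) < d := by exact_mod_cast hd
  cases k with
  | zero => simp [zonal]
  | succ k =>
    rw [zonal, Nat.add_sub_cancel, mul_sub, ← mul_assoc, ← mul_assoc _ (C _),
      ← map_natCast (C (σ := Fin (d + 2)) (R := ℝ)),
      ← map_natCast (C (σ := Fin (d + 2)) (R := ℝ)), ← map_natCast (C (σ := Fin (d + 2)) (R := ℝ)),
      ← C_mul, ← C_mul]
    congr 3
    · push_cast; field_simp
    · push_cast; field_simp

lemma dirDeriv_natCast {n : ℕ} (y : Fin n → ℝ) (a : ℕ) :
    dirDeriv y (a : MvPolynomial (Fin n) ℝ) = 0 := by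
  rw [← map_natCast (C (σ := Fin n) (R := ℝ)), dirDeriv_C]

lemma laplacian_natCast_mul {n : ℕ} (a : ℕ) (p : MvPolynomial (Fin n) ℝ) :
    laplacian ((a : MvPolynomial (Fin n) ℝ) * p) = a * laplacian p := by
  rw [← map_natCast (C (σ := Fin n) (R := ℝ)), laplacian_C_mul]

/-- Differentiating a zonal form towards its pole lowers the degree; this is what makes the
induction for harmonicity close. -/
lemma dirDeriv_zonal (hd : 0 < d) {y : Fin (d + 2) → ℝ} (hy : ∑ i, y i ^ 2 = 1) (k : ℕ) :
    dirDeriv y (zonal y k) = (k : MvPolynomial (Fin (d + 2)) ℝ) * zonal y (k - 1) := by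
  induction k using Nat.twoStepInduction with
  | zero => simpa [zonal] using dirDeriv_C y 1
  | one => simp [zonal, dirDeriv_linForm hy]
  | more k h0 h1 =>
    have h := congrArg (dirDeriv y) (zonal_rec hd y (k + 1))
    have hr := zonal_rec hd y k
    rw [dirDeriv_sub] at h
    simp only [dirDeriv_natCast, dirDeriv_mul, dirDeriv_linForm hy, dirDeriv_normSq,
      Nat.add_sub_cancel, h0, h1] at h
    have hne : ((k + 1 + d : ℕ) : MvPolynomial (Fin (d + 2)) ℝ) ≠ 0 := by
      exact_mod_cast (by omega : k + 1 + d ≠ 0)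
    apply mul_left_cancel₀ hne
    rw [show k + 2 - 1 = k + 1 by omega]
    push_cast at h hr ⊢
    linear_combination h - (k + 1) * hr

/-- The zonal polynomials are harmonic. -/
lemma laplacian_zonal (hd : 0 < d) {y : Fin (d + 2) → ℝ} (hy : ∑ i, y i ^ 2 = 1) (k : ℕ) :
    laplacian (zonal y k) = 0 := by
  induction k using Nat.twoStepInduction with
  | zero => simp [zonal, laplacian]
  | one => simp [zonal, laplacian, pderiv_linForm]
  | more k h0 h1 =>
    have h := congrArg laplacian (zonal_rec hd y (k + 1))
    rw [laplacian_sub] at h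
    simp only [laplacian_natCast_mul, laplacian_linForm_mul, dirDeriv_zonal hd hy,
      Nat.add_sub_cancel, laplacian_normSq_mul (isHomogeneous_zonal y k), h0, h1] at h
    have hne : ((k + 1 + d : ℕ) : MvPolynomial (Fin (d + 2)) ℝ) ≠ 0 := by
      exact_mod_cast (by omega : k + 1 + d ≠ 0)
    apply mul_left_cancel₀ hne
    push_cast at h ⊢
    linear_combination h

/-- Up to a positive factor, the Fischer product of a harmonic form of degree `k` with
`zonal x k` is evaluation at `x`. In the recurrence for `zonal x k` the term divisible by `normSq`
is orthogonal to harmonic polynomials, and the other one is `linForm x` times a zonal form, whose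
product with `q` is the product of that zonal form with `dirDeriv x q`; Euler's identity then
evaluates `dirDeriv x q` at `x`. -/
lemma exists_fischer_zonal (hd : 0 < d) (k : ℕ) : ∃ c : ℝ, 0 < c ∧
    ∀ (x : Fin (d + 2) → ℝ) (q : MvPolynomial (Fin (d + 2)) ℝ), q.IsHomogeneous k →
      laplacian q = 0 → fischer q (zonal x k) = c * eval x q := by
  have hd' : (0 : ℝ) < d := by exact_mod_cast hd
  induction k with
  | zero =>
    refine ⟨1, one_pos, fun x q hq _ => ?_⟩
    have hq' := totalDegree_eq_zero_iff_eq_C.1 (Nat.le_zero.1 hq.totalDegree_le)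
    have h1 : zonal x 0 = monomial 0 (1 : ℝ) := rfl
    rw [h1, fischer_monomial, hq']
    simp
  | succ k ih =>
    obtain ⟨c, hc, h⟩ := ih
    refine ⟨(2 * k + d) / (k + d) * (c * (k + 1)), by positivity, fun x q hq hl => ?_⟩
    have h1 := congrArg (fischer q) (zonal_rec hd x k)
    rw [map_sub, ← map_natCast (C (σ := Fin (d + 2)) (R := ℝ)),
      ← map_natCast (C (σ := Fin (d + 2)) (R := ℝ)), ← map_natCast (C (σ := Fin (d + 2)) (R := ℝ)),
      fischer_C_mul, fischer_C_mul, fischer_C_mul, fischer_linForm_mul, fischer_normSq_mul, hl,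
      h x _ (isHomogeneous_dirDeriv x hq), eval_dirDeriv_self x hq] at h1
    · have h0 : fischer (0 : MvPolynomial (Fin (d + 2)) ℝ) (zonal x (k - 1)) = 0 := by
        simpa using fischer_C_mul_left 0 0 (zonal x (k - 1))
      rw [h0] at h1
      push_cast at h1
      field_simp
      linear_combination h1
    · rw [laplacian_dirDeriv, hl]
      simp [dirDeriv]

/-- **Schoenberg**: Gegenbauer polynomials are positive definite on the sphere. -/
lemma posSemidef_gegenbauer (hd : 0 < d) {ι : Type*} [Fintype ι] (v : ι → Fin (d + 2) → ℝ)
    (hv : ∀ a, ∑ i, v a i ^ 2 = 1) (k : ℕ) :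
    (Matrix.of fun a b => gegenbauer d k (v a ⬝ᵥ v b)).PosSemidef := by
  obtain ⟨c, hc, h⟩ := exists_fischer_zonal hd k
  refine Matrix.PosSemidef.of_dotProduct_mulVec_nonneg ?_ fun w => ?_
  · ext a b
    simp [dotProduct_comm]
  · set q := ∑ b, C (w b) * zonal (v b) k with hq
    have hqh : q.IsHomogeneous k := IsHomogeneous.sum _ _ _ fun b _ => by
      simpa using (isHomogeneous_C _ (w b)).mul (isHomogeneous_zonal (v b) k)
    have hql : laplacian q = 0 := by
      have : laplacian q = ∑ b, laplacian (C (w b) * zonal (v b) k) := by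
        simp only [laplacian, hq, map_sum]
        exact sum_comm
      simp [this, laplacian_C_mul, laplacian_zonal hd (hv _)]
    have h2 : fischer q q = c * (star w ⬝ᵥ
        (Matrix.of fun a b => gegenbauer d k (v a ⬝ᵥ v b)).mulVec w) := by
      conv_lhs => rw [hq, map_sum]
      rw [← hq]
      simp only [fischer_C_mul, h _ q hqh hql, dotProduct, Matrix.mulVec, mul_sum]
      refine sum_congr rfl fun a _ => ?_
      rw [hq, map_sum]
      simp only [map_mul, eval_C, eval_zonal (hv _), mul_sum]
      exact sum_congr rfl fun b _ => by
        simp only [Pi.star_apply, star_trivial, Matrix.of_apply, dotProduct]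
        ring
    exact nonneg_of_mul_nonneg_right (h2 ▸ fischer_self_nonneg q) hc

end Zonal

/-! ### Rank bounds -/

open Matrix in
/-- The Cauchy–Schwarz inequality for the nonzero eigenvalues. -/
lemma trace_sq_le_rank_mul {ι : Type*} [Fintype ι] [DecidableEq ι] {A : Matrix ι ι ℝ}
    (hA : A.IsHermitian) : A.trace ^ 2 ≤ A.rank * (A * A).trace := by
  have h2 : (A * A).trace = ∑ i, hA.eigenvalues i ^ 2 := by
    have h := hA.spectral_theorem
    have h' : A * A = Unitary.conjStarAlgAut ℝ _ hA.eigenvectorUnitary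
        (diagonal (RCLike.ofReal ∘ hA.eigenvalues) * diagonal (RCLike.ofReal ∘ hA.eigenvalues)) := by
      rw [map_mul, ← h]
    rw [h', Unitary.conjStarAlgAut_apply, trace_mul_cycle]
    simp [diagonal_mul_diagonal, trace_diagonal, sq]
  have h1 : A.trace = ∑ i, hA.eigenvalues i := by
    simpa using hA.trace_eq_sum_eigenvalues
  rw [h1, h2, hA.rank_eq_card_non_zero_eigs, Fintype.card_subtype]
  rw [← sum_filter_ne_zero]
  refine sq_sum_le_card_mul_sum_sq.trans ?_
  refine mul_le_mul_of_nonneg_left ?_ (by positivity)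
  exact sum_le_sum_of_subset_of_nonneg (filter_subset _ _) fun _ _ _ => sq_nonneg _

/-- The values of forms of degree `k` give a matrix that factors through the monomials of
degree `k`. -/
lemma rank_eval_le {n k : ℕ} {ι : Type*} [Fintype ι] (v : ι → Fin n → ℝ)
    (p : ι → MvPolynomial (Fin n) ℝ) (hp : ∀ b, (p b).IsHomogeneous k) :
    (Matrix.of fun a b => eval (v a) (p b)).rank ≤ (n + k - 1).choose k := by
  set S : Finset (Fin n →₀ ℕ) := finsuppAntidiag univ k with hS
  have hcard : Fintype.card S = (n + k - 1).choose k := by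
    rw [Fintype.card_coe, hS, card_finsuppAntidiag_nat_eq_choose]; simp
  have h : (Matrix.of fun a b => eval (v a) (p b)) =
      (Matrix.of fun (a : ι) (m : S) => ∏ i, v a i ^ (m.1 i)) *
      (Matrix.of fun (m : S) (b : ι) => coeff m.1 (p b)) := by
    ext a b
    rw [Matrix.mul_apply]
    simp only [Matrix.of_apply]
    rw [eval_eq', sum_coe_sort S (fun m => (∏ i, v a i ^ (m i)) * coeff m (p b))]
    refine sum_subset_zero_on_sdiff ?_ ?_ ?_
    · intro m hm
      have := hp b (mem_support_iff.1 hm)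
      rw [hS, mem_finsuppAntidiag]
      refine ⟨?_, subset_univ _⟩
      simpa [Finsupp.weight_apply, Finsupp.sum_fintype] using this
    · intro m hm
      have := notMem_support_iff.1 (mem_sdiff.1 hm).2
      rw [this, mul_zero]
    · intro m _; ring
  rw [h, ← hcard]
  exact (Matrix.rank_mul_le_left _ _).trans (Matrix.rank_le_card_width _)

/-! ### The linear programming bound -/

lemma sum_mul_nonneg_of_posSemidef {ι : Type*} [Fintype ι] {A B : Matrix ι ι ℝ}
    (hA : A.PosSemidef) (hB : B.PosSemidef) : 0 ≤ ∑ a, ∑ b, A a b * B a b := by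
  have h := (hA.hadamard hB).dotProduct_mulVec_nonneg (fun _ => 1)
  simpa [dotProduct, Matrix.mulVec] using h

lemma matrix_rank_add_le {ι κ : Type*} [Fintype κ] [Finite ι] (A B : Matrix ι κ ℝ) :
    (A + B).rank ≤ A.rank + B.rank := by
  rw [Matrix.rank, Matrix.rank, Matrix.rank, Matrix.mulVecLin_add]
  refine (Submodule.finrank_mono ?_).trans (Submodule.finrank_add_le_finrank_add_finrank _ _)
  rintro _ ⟨x, rfl⟩
  exact Submodule.add_mem_sup ⟨x, rfl⟩ ⟨x, rfl⟩

section Kernel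
variable {d : ℕ}

/-- The test polynomial: the combination of Gegenbauer polynomials of degrees `j - 1`, `j` and
`j + 1` with coefficients `j / (2 * j + d)`, `l` and `(j + d) / (2 * j + d)`. For `j = 0` the first
term vanishes. -/
noncomputable def klPoly (d j : ℕ) (l t : ℝ) : ℝ :=
  j / (2 * j + d) * gegenbauer d (j - 1) t + l * gegenbauer d j t +
    (j + d) / (2 * j + d) * gegenbauer d (j + 1) t

/-- For the right value of `l`, multiplication by `t` acts on `klPoly d j l` as the scalar `l`,
up to a nonnegative combination of Gegenbauer polynomials. -/
lemma mul_klPoly (hd : 2 ≤ d) (j : ℕ) {l : ℝ}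
    (hl : l ^ 2 = j / (2 * j + d) * ((j + d - 1) / (2 * j + d - 2)) +
      (j + d) / (2 * j + d) * ((j + 1) / (2 * j + d + 2))) (t : ℝ) :
    t * klPoly d j l t = l * klPoly d j l t +
      (j / (2 * j + d) * ((j - 1 : ℕ) / (2 * (j - 1 : ℕ) + d)) * gegenbauer d (j - 1 - 1) t +
        (j + d) / (2 * j + d) * ((j + d + 1) / (2 * j + d + 2)) * gegenbauer d (j + 2) t) := by
  have h0 := gegenbauer_rec (by omega : 0 < d) j t
  have h1 := gegenbauer_rec (by omega : 0 < d) (j + 1) t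
  have h2 := gegenbauer_rec (by omega : 0 < d) (j - 1) t
  have h2' : (j : ℝ) / (2 * j + d) * (t * gegenbauer d (j - 1) t) = j / (2 * j + d) *
      ((j + d - 1) / (2 * j + d - 2) * gegenbauer d j t +
        ((j - 1 : ℕ) / (2 * (j - 1 : ℕ) + d)) * gegenbauer d (j - 1 - 1) t) := by
    cases j with
    | zero => simp
    | succ j =>
      rw [h2]
      simp only [Nat.add_sub_cancel]
      push_cast
      ring_nf
  have h1' : t * gegenbauer d (j + 1) t = (j + d + 1) / (2 * j + d + 2) * gegenbauer d (j + 2) t +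
      (j + 1) / (2 * j + d + 2) * gegenbauer d j t := by
    rw [h1]
    simp only [Nat.add_sub_cancel]
    push_cast
    ring_nf
  simp only [klPoly]
  linear_combination h2' + l * h0 + (j + d) / (2 * j + d) * h1' - gegenbauer d j t * hl

variable {ι : Type*} [Fintype ι]

/-- Both the terms of degrees `j - 1` and `j + 1` come from forms of degree `j + 1`, because
`normSq` is `1` on the sphere. -/
lemma rank_klPoly_le (v : ι → Fin (d + 2) → ℝ)
    (hv : ∀ a, ∑ i, v a i ^ 2 = 1) (j : ℕ) (l : ℝ) :
    (Matrix.of fun a b => klPoly d j l (v a ⬝ᵥ v b)).rank ≤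
      (d + 2 + j).choose (j + 1) + (d + 1 + j).choose j := by
  have h : (Matrix.of fun a b => klPoly d j l (v a ⬝ᵥ v b)) =
      (Matrix.of fun a b => eval (v a) (C (j / (2 * j + d) : ℝ) *
        (normSq (d + 2) * zonal (v b) (j - 1)) +
        C ((j + d) / (2 * j + d) : ℝ) * zonal (v b) (j + 1))) +
      (Matrix.of fun a b => eval (v a) (C l * zonal (v b) j)) := by
    ext a b
    simp only [klPoly, Matrix.of_apply, Matrix.add_apply, map_add, map_mul, eval_C, eval_normSq,
      hv, eval_zonal (hv _)]
    ring
  rw [h]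
  refine (matrix_rank_add_le _ _).trans (add_le_add ?_ ?_)
  · refine (rank_eval_le (k := j + 1) v _ fun b => IsHomogeneous.add ?_ ?_).trans_eq ?_
    · cases j with
      | zero => simpa using isHomogeneous_zero _ _ _
      | succ j =>
        have := (isHomogeneous_C (Fin (d + 2)) (((j + 1 : ℕ) : ℝ) / (2 * (j + 1 : ℕ) + d))).mul
          (isHomogeneous_normSq.mul (isHomogeneous_zonal (v b) j))
        rwa [show 0 + (2 + j) = j + 1 + 1 by ring] at this
    · simpa using (isHomogeneous_C (Fin (d + 2)) ((j + d : ℝ) / (2 * j + d))).mul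
        (isHomogeneous_zonal (v b) (j + 1))
    · congr 1
  · refine (rank_eval_le (k := j) v _ fun b => ?_).trans_eq ?_
    · simpa using (isHomogeneous_C (Fin (d + 2)) l).mul (isHomogeneous_zonal (v b) j)
    · congr 1; omega

/-- The linear programming bound: `l` plays the role of the largest root of a Gegenbauer
polynomial, and the binomial coefficients count the monomials of degrees `j + 1` and `j` in
`d + 2` variables. -/
theorem card_mul_le_of_code [Nonempty ι] (hd : 2 ≤ d) (v : ι → Fin (d + 2) → ℝ)
    (hv : ∀ a, ∑ i, v a i ^ 2 = 1) {s : ℝ} (hs : ∀ a b, a ≠ b → v a ⬝ᵥ v b ≤ s) (j : ℕ) {l : ℝ}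
    (hl : l ^ 2 = j / (2 * j + d) * ((j + d - 1) / (2 * j + d - 2)) +
      (j + d) / (2 * j + d) * ((j + 1) / (2 * j + d + 2))) (hl0 : 0 ≤ l) (hsl : s < l) :
    Fintype.card ι * (l - s) ≤
      (1 - s) * ((d + 2 + j).choose (j + 1) + (d + 1 + j).choose j : ℕ) := by
  classical
  have hd0 : 0 < d := by omega
  have hdR : (0 : ℝ) < d := by exact_mod_cast hd0
  set N : ℝ := (Fintype.card ι : ℝ) with hN
  have hNpos : 0 < N := by rw [hN]; exact_mod_cast Fintype.card_pos
  set D : ℕ := (d + 2 + j).choose (j + 1) + (d + 1 + j).choose j with hD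
  have hself : ∀ a, v a ⬝ᵥ v a = 1 := fun a => by simpa [dotProduct, sq] using hv a
  have hG := posSemidef_gegenbauer hd0 v hv
  set F : Matrix ι ι ℝ := Matrix.of fun a b => klPoly d j l (v a ⬝ᵥ v b) with hF
  set f : ℝ := klPoly d j l 1 with hf
  have hfpos : 0 < f := by
    simp only [hf, klPoly, gegenbauer_one]
    positivity
  have hFpsd : F.PosSemidef := by
    have h := (((hG (j - 1)).smul (by positivity : (0 : ℝ) ≤ j / (2 * j + d))).add
      ((hG j).smul hl0)).add ((hG (j + 1)).smul (by positivity : (0 : ℝ) ≤ (j + d) / (2 * j + d)))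
    convert h using 1
    ext a b
    simp [hF, klPoly]
  set R : Matrix ι ι ℝ :=
    ((j : ℝ) / (2 * j + d) * ((j - 1 : ℕ) / (2 * (j - 1 : ℕ) + d))) •
      (Matrix.of fun a b => gegenbauer d (j - 1 - 1) (v a ⬝ᵥ v b)) +
    ((j + d : ℝ) / (2 * j + d) * ((j + d + 1) / (2 * j + d + 2))) •
      (Matrix.of fun a b => gegenbauer d (j + 2) (v a ⬝ᵥ v b)) with hR
  have hRpsd : R.PosSemidef :=
    ((hG _).smul (by positivity)).add ((hG _).smul (by positivity))
  -- `F` is an eigenvector up to the positive semidefinite remainder `R`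
  have hmul : ∀ a b, (v a ⬝ᵥ v b - s) * F a b ^ 2 = (l - s) * F a b ^ 2 + R a b * F a b := by
    intro a b
    have := mul_klPoly hd j hl (v a ⬝ᵥ v b)
    simp only [hF, hR, Matrix.of_apply, Matrix.add_apply, Matrix.smul_apply, smul_eq_mul]
    linear_combination klPoly d j l (v a ⬝ᵥ v b) * this
  have hupper : ∑ a, ∑ b, (v a ⬝ᵥ v b - s) * F a b ^ 2 ≤ N * ((1 - s) * f ^ 2) := by
    have : ∀ a, ∑ b, (v a ⬝ᵥ v b - s) * F a b ^ 2 ≤ (1 - s) * f ^ 2 := by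
      intro a
      rw [← add_sum_erase _ _ (mem_univ a), hself, hF]
      simp only [Matrix.of_apply, hself]
      refine add_le_of_nonpos_right (sum_nonpos fun b hb => ?_)
      exact mul_nonpos_of_nonpos_of_nonneg (by linarith [hs a b (ne_of_mem_erase hb).symm])
        (sq_nonneg _)
    refine (sum_le_sum fun a _ => this a).trans_eq ?_
    simp [hN]
  have hlower : (l - s) * ∑ a, ∑ b, F a b ^ 2 ≤ ∑ a, ∑ b, (v a ⬝ᵥ v b - s) * F a b ^ 2 := by
    simp only [hmul, sum_add_distrib, ← mul_sum]
    linarith [sum_mul_nonneg_of_posSemidef hRpsd hFpsd]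
  have hwelch : (N * f) ^ 2 ≤ D * ∑ a, ∑ b, F a b ^ 2 := by
    have h := trace_sq_le_rank_mul hFpsd.isHermitian
    have h1 : F.trace = N * f := by
      simp [Matrix.trace, hF, hself, hN, hf]
    have h2 : (F * F).trace = ∑ a, ∑ b, F a b ^ 2 := by
      simp only [Matrix.trace, Matrix.diag, Matrix.mul_apply]
      refine sum_congr rfl fun a _ => sum_congr rfl fun b _ => ?_
      rw [sq]; congr 1
      simp [hF, dotProduct_comm]
    rw [h1, h2] at h
    refine h.trans (mul_le_mul_of_nonneg_right ?_ (by positivity))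
    exact_mod_cast rank_klPoly_le v hv j l
  have hfin : (N * f ^ 2) * (N * (l - s)) ≤ (N * f ^ 2) * ((1 - s) * D) := by
    calc (N * f ^ 2) * (N * (l - s)) = (l - s) * (N * f) ^ 2 := by ring
      _ ≤ (l - s) * (D * ∑ a, ∑ b, F a b ^ 2) :=
        mul_le_mul_of_nonneg_left hwelch (by linarith)
      _ = D * ((l - s) * ∑ a, ∑ b, F a b ^ 2) := by ring
      _ ≤ D * (N * ((1 - s) * f ^ 2)) :=
        mul_le_mul_of_nonneg_left (hlower.trans hupper) (by positivity)
      _ = _ := by ring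
  exact le_of_mul_le_mul_left hfin (by positivity)

end Kernel

/-! ### Estimates -/

/-- Log-convexity of the Gamma function between the integers around `x + 1`. -/
lemma Gamma_add_one_le_factorial_mul_rpow {x m : ℝ} (hx : 0 ≤ x) (hm : (⌊x⌋₊ : ℝ) + 1 ≤ m) :
    Real.Gamma (x + 1) ≤ (⌊x⌋₊.factorial : ℝ) * m ^ (x - ⌊x⌋₊) := by
  set p := ⌊x⌋₊ with hp
  have hpx : (p : ℝ) ≤ x := Nat.floor_le hx
  have hxp : x < p + 1 := Nat.lt_floor_add_one x
  rcases hpx.eq_or_lt with h | h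
  · rw [← h, Real.Gamma_nat_eq_factorial]; simp
  have hG : (0 : ℝ) < p.factorial := by positivity
  have h1 := Real.Gamma_mul_add_mul_le_rpow_Gamma_mul_rpow_Gamma (s := p + 1) (t := (p + 1 : ℕ) + 1)
    (a := 1 - (x - p)) (b := x - p) (by positivity) (by positivity) (by linarith) (by linarith)
    (by ring)
  rw [Real.Gamma_nat_eq_factorial, Real.Gamma_nat_eq_factorial, Nat.factorial_succ, mul_comm (p + 1),
    Nat.cast_mul, Real.mul_rpow (by positivity) (by positivity), ← mul_assoc,
    ← Real.rpow_add hG] at h1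
  have e : (1 - (x - p)) * ((p : ℝ) + 1) + (x - p) * ((p + 1 : ℕ) + 1) = x + 1 := by
    push_cast; ring
  rw [e, sub_add_cancel, Real.rpow_one] at h1
  refine h1.trans (mul_le_mul_of_nonneg_left ?_ hG.le)
  exact Real.rpow_le_rpow (by positivity) (by exact_mod_cast hm) (by linarith)

lemma pow_div_factorial_le_rpow_div_Gamma {x m : ℝ} (hx : 0 ≤ x) (hm : (⌊x⌋₊ : ℝ) + 1 ≤ m) :
    m ^ (⌊x⌋₊ + 2) / (⌊x⌋₊.factorial : ℝ) ≤ m ^ (x + 2) / Real.Gamma (x + 1) := by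
  have hm0 : 0 < m := lt_of_lt_of_le (by positivity) hm
  rw [div_le_div_iff₀ (by positivity) (Real.Gamma_pos_of_pos (by linarith))]
  refine (mul_le_mul_of_nonneg_left (Gamma_add_one_le_factorial_mul_rpow hx hm)
    (by positivity)).trans_eq ?_
  have : x + 2 = (⌊x⌋₊ + 2 : ℕ) + (x - ⌊x⌋₊) := by push_cast; ring
  rw [this, Real.rpow_add hm0, Real.rpow_natCast]
  ring

/-- The linear programming bound for `s = γ / √n`, when `√n * l` exceeds `γ` by at least `δ`. -/
lemma card_mul_le_sqrt {d : ℕ} (hd : 2 ≤ d) {ι : Type*} [Fintype ι] [Nonempty ι]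
    (v : ι → Fin (d + 2) → ℝ) (hv : ∀ a, ∑ i, v a i ^ 2 = 1) {γ δ : ℝ} (hγ : 0 ≤ γ) (hδ : 0 < δ)
    (hs : ∀ a b, a ≠ b → v a ⬝ᵥ v b ≤ γ / √((d + 2 : ℕ) : ℝ)) (j : ℕ)
    (h : (γ + δ) ^ 2 ≤ (d + 2 : ℕ) * (j / (2 * j + d) * ((j + d - 1) / (2 * j + d - 2)) +
      (j + d) / (2 * j + d) * ((j + 1) / (2 * j + d + 2)) : ℝ)) :
    Fintype.card ι * δ ≤
      ((d + 2 + j).choose (j + 1) + (d + 1 + j).choose j : ℕ) * √((d + 2 : ℕ) : ℝ) := by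
  set L : ℝ := j / (2 * j + d) * ((j + d - 1) / (2 * j + d - 2)) +
      (j + d) / (2 * j + d) * ((j + 1) / (2 * j + d + 2)) with hL
  set n : ℝ := ((d + 2 : ℕ) : ℝ) with hn
  have hn0 : 0 < n := by rw [hn]; positivity
  have hr : 0 < √n := Real.sqrt_pos.2 hn0
  have hL0 : 0 ≤ L := nonneg_of_mul_nonneg_right ((sq_nonneg _).trans h) hn0
  have hl : γ + δ ≤ √n * √L := by
    rw [← Real.sqrt_mul hn0.le]
    exact Real.le_sqrt_of_sq_le h
  have hgap : δ / √n ≤ √L - γ / √n := by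
    rw [le_sub_iff_add_le, ← add_div, div_le_iff₀ hr]
    linarith
  have hgap0 : 0 < δ / √n := by positivity
  have key := card_mul_le_of_code hd v hv hs j (l := √L) (Real.sq_sqrt hL0) (Real.sqrt_nonneg _)
    (by linarith)
  have h1 : (Fintype.card ι : ℝ) * (δ / √n) ≤
      ((d + 2 + j).choose (j + 1) + (d + 1 + j).choose j : ℕ) := by
    refine (mul_le_mul_of_nonneg_left hgap (by positivity)).trans (key.trans ?_)
    refine mul_le_of_le_one_left (by positivity) ?_
    have : 0 ≤ γ / √n := by positivity
    linarith
  rwa [← mul_div_assoc, div_le_iff₀ hr] at h1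

/-- A lower bound for `n * l ^ 2`. It is at least `p * n / (n + 2 * p + 2)`, which increases with
both `p` and `n`; inserting `p = γ ^ 2 + 2 * γ` and `n = 2 * γ * (γ + 1) ^ 2` gives
`γ ^ 2 + γ ^ 2 / (γ + 1)`. -/
lemma le_mul_recurrence_coeff {d j p : ℕ} (hd : 2 ≤ d) (hpj : p ≤ 2 * j + 1) {γ : ℝ} (hγ : 1 ≤ γ)
    (hp : (γ + 1) ^ 2 ≤ p + 1) (hn : 2 * γ * (γ + 1) ^ 2 ≤ (d + 2 : ℕ)) :
    (γ + 1 / 5) ^ 2 ≤ (d + 2 : ℕ) * (j / (2 * j + d) * ((j + d - 1) / (2 * j + d - 2)) +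
      (j + d) / (2 * j + d) * ((j + 1) / (2 * j + d + 2)) : ℝ) := by
  have hd' : (2 : ℝ) ≤ d := by exact_mod_cast hd
  have hj : (0 : ℝ) ≤ j := by positivity
  have hpj' : (p : ℝ) ≤ 2 * j + 1 := by exact_mod_cast hpj
  push_cast at hn ⊢
  have hp0 : (3 : ℝ) ≤ p := by nlinarith
  have h1 : (j : ℝ) / (2 * j + d) * ((j + d) / (2 * j + d + 2)) ≤
      j / (2 * j + d) * ((j + d - 1) / (2 * j + d - 2)) := by
    rcases Nat.eq_zero_or_pos j with rfl | hj1
    · simp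
    have hj1 : (1 : ℝ) ≤ j := by exact_mod_cast hj1
    refine mul_le_mul_of_nonneg_left ?_ (by positivity)
    rw [div_le_div_iff₀ (by positivity) (by linarith)]
    nlinarith
  have h2 : (p : ℝ) / (d + 2 + 2 * p + 2) ≤ (2 * j + 1) / (d + 2 + 2 * (2 * j + 1) + 2) := by
    rw [div_le_div_iff₀ (by positivity) (by positivity)]
    nlinarith
  have h3 : (2 * j + 1 : ℝ) / (d + 2 + 2 * (2 * j + 1) + 2) ≤
      j / (2 * j + d) * ((j + d) / (2 * j + d + 2)) +
      (j + d) / (2 * j + d) * ((j + 1) / (2 * j + d + 2)) := by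
    have e : (j : ℝ) / (2 * j + d) * ((j + d) / (2 * j + d + 2)) +
      (j + d) / (2 * j + d) * ((j + 1) / (2 * j + d + 2)) =
      (2 * j + 1) * (j + d) / ((2 * j + d) * (2 * j + d + 2)) := by field_simp; ring
    rw [e, div_le_div_iff₀ (by positivity) (by positivity), mul_assoc]
    refine mul_le_mul_of_nonneg_left ?_ (by positivity)
    nlinarith
  have h4 : γ ^ 2 + γ ^ 2 / (γ + 1) ≤ (d + 2) * ((p : ℝ) / (d + 2 + 2 * p + 2)) := by
    have e : γ ^ 2 + γ ^ 2 / (γ + 1) = γ * (γ ^ 2 + 2 * γ) / (γ + 1) := by field_simp; ring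
    rw [e, ← mul_div_assoc, div_le_div_iff₀ (by positivity) (by positivity)]
    have hA : γ ^ 2 + 2 * γ ≤ p := by linarith
    have hc : 0 ≤ (γ + 1) * (d + 2) - 2 * γ * (γ ^ 2 + 2 * γ) := by nlinarith
    have h5 := mul_nonneg hc (sub_nonneg.2 hA)
    have h6 : 0 ≤ (γ ^ 2 + 2 * γ) * ((d : ℝ) + 2 - 2 * γ * (γ + 1) ^ 2) :=
      mul_nonneg (by positivity) (by linarith)
    linear_combination h5 + h6
  have h7 : (γ + 1 / 5) ^ 2 ≤ γ ^ 2 + γ ^ 2 / (γ + 1) := by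
    have : γ / 2 ≤ γ ^ 2 / (γ + 1) := by
      rw [div_le_div_iff₀ (by positivity) (by positivity)]; nlinarith
    nlinarith
  refine h7.trans (h4.trans (mul_le_mul_of_nonneg_left ?_ (by positivity)))
  exact h2.trans (h3.trans (add_le_add_left h1 _))

lemma choose_add_choose_mul_factorial_le {n j p : ℕ} (hn : 1 ≤ n) (hjp : j + 1 ≤ p) :
    ((n + j).choose (j + 1) + (n - 1 + j).choose j) * p.factorial ≤
      (n + j) ^ j * p ^ (p - (j + 1)) * (n + 2 * j + 1) := by
  obtain ⟨m, rfl⟩ : ∃ m, n = m + 1 := ⟨n - 1, by omega⟩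
  have h1 : (m + j).choose j * j.factorial ≤ (m + 1 + j) ^ j := by
    rw [mul_comm, ← Nat.descFactorial_eq_factorial_mul_choose]
    exact (Nat.descFactorial_le_pow _ _).trans (Nat.pow_le_pow_left (by omega) _)
  have h2 : p.factorial ≤ (j + 1).factorial * p ^ (p - (j + 1)) := by
    rw [← Nat.factorial_mul_descFactorial (Nat.sub_le p (j + 1)), Nat.sub_sub_self hjp]
    exact Nat.mul_le_mul_left _ (Nat.descFactorial_le_pow _ _)
  have h3 := Nat.add_one_mul_choose_eq (m + j) j
  rw [Nat.add_sub_cancel, show m + 1 + j = m + j + 1 by ring] at *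
  calc ((m + j + 1).choose (j + 1) + (m + j).choose j) * p.factorial
      ≤ ((m + j + 1).choose (j + 1) + (m + j).choose j) *
        ((j + 1).factorial * p ^ (p - (j + 1))) := Nat.mul_le_mul_left _ h2
    _ = ((m + j).choose j * j.factorial) * p ^ (p - (j + 1)) * (m + 1 + 2 * j + 1) := by
        rw [Nat.factorial_succ]
        linear_combination (j.factorial * p ^ (p - (j + 1))) * h3.symm
    _ ≤ _ := by gcongr

lemma choose_add_choose_mul_sqrt_le {n p : ℕ} (hp : 4 ≤ p) (hn : 2 * p ≤ n) :
    (((n + p / 2).choose (p / 2 + 1) + (n - 1 + p / 2).choose (p / 2) : ℕ) : ℝ) * √(n : ℝ) * 5 ≤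
      ((n : ℝ) - 1) ^ (p + 2) / p.factorial := by
  set j := p / 2 with hj
  have h1 := choose_add_choose_mul_factorial_le (n := n) (j := j) (p := p) (by omega) (by omega)
  have hpR : (4 : ℝ) ≤ p := by exact_mod_cast hp
  have hnR : 2 * (p : ℝ) ≤ n := by exact_mod_cast hn
  have hjR : 2 * (j : ℝ) ≤ p := by exact_mod_cast (by omega : 2 * j ≤ p)
  -- After clearing factorials, each factor `n + j` is paired with one factor `p` of `p!`.
  have hpair : ((n : ℝ) + j) * p ≤ (n - 1) ^ 2 := by nlinarith
  have hpow : ((n : ℝ) + j) ^ j * p ^ (p - (j + 1)) ≤ 3 / 2 * (n - 1) ^ (p - 1) := by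
    rcases (by omega : p = 2 * j + 1 ∨ p = 2 * (j - 1) + 2) with h | h
    · rw [show p - (j + 1) = j by omega, ← mul_pow, show p - 1 = 2 * j by omega, pow_mul]
      have := pow_le_pow_left₀ (by positivity) hpair j
      have h0 : (0 : ℝ) ≤ (((n : ℝ) - 1) ^ 2) ^ j := by positivity
      linarith
    · have hsucc : ((n : ℝ) + j) ^ j = (n + j) ^ (j - 1) * (n + j) := by
        rw [← pow_succ]; congr 1; omega
      rw [show p - (j + 1) = j - 1 by omega, show p - 1 = 2 * (j - 1) + 1 by omega, hsucc,
        pow_succ ((n : ℝ) - 1), pow_mul, mul_right_comm, ← mul_pow]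
      have h2 := pow_le_pow_left₀ (by positivity) hpair (j - 1)
      have h3 : (n : ℝ) + j ≤ 3 / 2 * (n - 1) := by linarith
      calc _ ≤ (((n : ℝ) - 1) ^ 2) ^ (j - 1) * (3 / 2 * (n - 1)) :=
            mul_le_mul h2 h3 (by positivity) (by positivity)
        _ = _ := by ring
  have hsqrt : √(n : ℝ) ≤ 3 / 8 * n := by
    rw [Real.sqrt_le_left (by positivity)]
    nlinarith
  have hcub : 3 / 2 * ((n : ℝ) + 2 * j + 1) * (3 / 8 * n) * 5 ≤ (n - 1) ^ 3 := by
    have h8 : (8 : ℝ) ≤ n := by linarith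
    have : (n : ℝ) + 2 * j + 1 ≤ 3 / 2 * n + 1 := by linarith
    have h9 : 3 / 2 * ((n : ℝ) + 2 * j + 1) * (3 / 8 * n) * 5 ≤
      3 / 2 * (3 / 2 * n + 1) * (3 / 8 * n) * 5 := by gcongr
    nlinarith [mul_nonneg (sub_nonneg.2 h8) (sub_nonneg.2 h8),
      mul_nonneg (mul_nonneg (sub_nonneg.2 h8) (sub_nonneg.2 h8)) (sub_nonneg.2 h8)]
  have h1R : (((n + j).choose (j + 1) + (n - 1 + j).choose j : ℕ) : ℝ) * p.factorial ≤
      (n + j) ^ j * p ^ (p - (j + 1)) * (n + 2 * j + 1) := by exact_mod_cast h1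
  have hn1 : (0 : ℝ) ≤ n - 1 := by linarith
  rw [le_div_iff₀ (by positivity)]
  calc _ = (((n + j).choose (j + 1) + (n - 1 + j).choose j : ℕ) : ℝ) * p.factorial * √n * 5 := by
        ring
    _ ≤ 3 / 2 * (n - 1) ^ (p - 1) * (n + 2 * j + 1) * (3 / 8 * n) * 5 := by
        refine mul_le_mul_of_nonneg_right (mul_le_mul ?_ hsqrt (by positivity) (by positivity))
          (by norm_num)
        exact h1R.trans (mul_le_mul_of_nonneg_right hpow (by positivity))
    _ = (n - 1) ^ (p - 1) * (3 / 2 * ((n : ℝ) + 2 * j + 1) * (3 / 8 * n) * 5) := by ring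
    _ ≤ (n - 1) ^ (p - 1) * (n - 1) ^ 3 := by gcongr
    _ = _ := by rw [← pow_add]; congr 1; omega

/-- The theorem for a finite code, given as a nonempty family of unit vectors. -/
lemma card_le_of_code {γ : ℝ} (hγ : 0 < γ) {n : ℕ} (hn4 : 4 ≤ n)
    (hn : 2 * γ * (⌈(γ + 1) ^ 2⌉ : ℝ) ≤ (n : ℝ)) {ι : Type*} [Fintype ι] [Nonempty ι]
    (v : ι → Fin n → ℝ) (hv : ∀ a, ∑ i, v a i ^ 2 = 1)
    (hs : ∀ a b, a ≠ b → v a ⬝ᵥ v b ≤ γ / √(n : ℝ)) :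
    (Fintype.card ι : ℝ) ≤
      ((n : ℝ) - 1) ^ (γ ^ 2 + 2 * γ + 3) / Real.Gamma (γ ^ 2 + 2 * γ + 2) := by
  have hx0 : 0 ≤ (γ + 1) ^ 2 := sq_nonneg _
  have hceil : (γ + 1) ^ 2 ≤ (⌈(γ + 1) ^ 2⌉ : ℝ) := Int.le_ceil _
  have hnx : 2 * γ * (γ + 1) ^ 2 ≤ n := (mul_le_mul_of_nonneg_left hceil (by positivity)).trans hn
  set p := ⌊(γ + 1) ^ 2⌋₊ with hp
  have hpx : (p : ℝ) ≤ (γ + 1) ^ 2 := Nat.floor_le hx0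
  have hxp : (γ + 1) ^ 2 < p + 1 := Nat.lt_floor_add_one _
  have hp1 : 1 ≤ p := Nat.le_floor (by push_cast; nlinarith)
  have hn4R : (4 : ℝ) ≤ n := by exact_mod_cast hn4
  suffices h : (p : ℝ) + 1 ≤ n - 1 ∧
      (Fintype.card ι : ℝ) ≤ ((n : ℝ) - 1) ^ (p + 2) / p.factorial by
    have h2 := h.2.trans (pow_div_factorial_le_rpow_div_Gamma hx0 h.1)
    rwa [show (γ + 1) ^ 2 + 2 = γ ^ 2 + 2 * γ + 3 by ring,
      show (γ + 1) ^ 2 + 1 = γ ^ 2 + 2 * γ + 2 by ring] at h2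
  clear_value p
  have hsqrt : √(n : ℝ) ≤ (n + 4) / 4 := by
    rw [Real.sqrt_le_left (by positivity)]
    nlinarith [sq_nonneg ((n : ℝ) - 4)]
  obtain ⟨d, rfl⟩ : ∃ d, n = d + 2 := ⟨n - 2, by omega⟩
  have hd : 2 ≤ d := by omega
  have hdR : (2 : ℝ) ≤ d := by exact_mod_cast hd
  rcases (by omega : p ≤ 2 ∨ p = 3 ∨ 4 ≤ p) with h | h | h
  · -- For `p ≤ 2` take `j = 0`, for which `n * l ^ 2 = 1`.
    have hγ1 : γ < 1 := by
      have : (p : ℝ) ≤ 2 := by exact_mod_cast h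
      nlinarith
    have key := card_mul_le_sqrt hd v hv hγ.le (δ := 1 - γ) (by linarith) hs 0 (by
      simp; field_simp; linarith)
    have hD : (((d + 2 + 0).choose (0 + 1) + (d + 1 + 0).choose 0 : ℕ) : ℝ) = d + 3 := by
      simp; ring
    rw [hD] at key
    have key2 := key.trans (mul_le_mul_of_nonneg_left hsqrt (by positivity))
    push_cast at key2 ⊢
    rcases (by omega : p = 1 ∨ p = 2) with rfl | rfl
    · refine ⟨by norm_num; linarith, ?_⟩
      -- `γ < √2 - 1`, and `29 / 50` is just below `2 - √2`
      have hg : 29 / 50 ≤ 1 - γ := by norm_num at hxp; nlinarith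
      have h5 := (mul_le_mul_of_nonneg_left hg (by positivity : (0 : ℝ) ≤ Fintype.card ι)).trans key2
      norm_num
      nlinarith [mul_nonneg (sub_nonneg.2 hdR) (sub_nonneg.2 hdR),
        mul_nonneg (mul_nonneg (sub_nonneg.2 hdR) (sub_nonneg.2 hdR)) (sub_nonneg.2 hdR)]
    · refine ⟨by norm_num; linarith, ?_⟩
      -- `γ < √3 - 1`, and `1339 / 5000` is just below `2 - √3`
      have hg : 1339 / 5000 ≤ 1 - γ := by norm_num at hxp; nlinarith
      have h5 := (mul_le_mul_of_nonneg_left hg (by positivity : (0 : ℝ) ≤ Fintype.card ι)).trans key2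
      norm_num
      have e2 := mul_nonneg (sub_nonneg.2 hdR) (sub_nonneg.2 hdR)
      nlinarith [e2, mul_nonneg e2 (sub_nonneg.2 hdR), mul_nonneg e2 e2]
  · -- For `p = 3` take `j = 1`, for which `n * l ^ 2 = 3 * n / (n + 2)`.
    subst h
    have hγ1 : γ < 1 := by norm_num at hxp; nlinarith
    have hγ2 : 7 / 10 < γ := by norm_num at hpx; nlinarith
    -- for `n = 4` the hypothesis `2 * γ * (γ + 1) ^ 2 ≤ n` would fail
    have hd3 : 3 ≤ d := by
      by_contra hlt
      have : d = 2 := by omega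
      subst this
      norm_num at hnx hpx
      nlinarith
    have hd3R : (3 : ℝ) ≤ d := by exact_mod_cast hd3
    have key := card_mul_le_sqrt hd v hv hγ.le (δ := 23 / 50) (by norm_num) hs 1 (by
      have e : ((d + 2 : ℕ) : ℝ) * (((1 : ℕ) : ℝ) / (2 * (1 : ℕ) + d) *
        (((1 : ℕ) + d - 1) / (2 * (1 : ℕ) + d - 2)) +
        ((1 : ℕ) + d) / (2 * (1 : ℕ) + d) * (((1 : ℕ) + 1) / (2 * (1 : ℕ) + d + 2))) =
          3 * (d + 2) / (d + 4) := by
        push_cast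
        rw [show (1 : ℝ) + d - 1 = d by ring, show (2 : ℝ) * 1 + d - 2 = d by ring]
        field_simp
        ring
      rw [e, le_div_iff₀ (by positivity)]
      have : (γ + 23 / 50) ^ 2 ≤ (73 / 50) ^ 2 := by gcongr; linarith
      nlinarith)
    have hD : (((d + 2 + 1).choose (1 + 1) + (d + 1 + 1).choose 1 : ℕ) : ℝ) =
        (d + 3) * (d + 2) / 2 + (d + 2) := by
      rw [Nat.choose_one_right]
      push_cast [Nat.cast_choose_two]
      ring
    rw [hD] at key
    have key2 := key.trans (mul_le_mul_of_nonneg_left hsqrt (by positivity))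
    push_cast at key2 ⊢
    refine ⟨by linarith, ?_⟩
    have e2 := mul_nonneg (sub_nonneg.2 hd3R) (sub_nonneg.2 hd3R)
    have e3 := mul_nonneg e2 (sub_nonneg.2 hd3R)
    norm_num [Nat.factorial]
    nlinarith [e2, e3, mul_nonneg e2 e2, mul_nonneg e2 e3]
  · have hpR : (4 : ℝ) ≤ p := by exact_mod_cast h
    have hγ1 : 1 ≤ γ := by nlinarith
    have hnp : 2 * (p : ℝ) ≤ (d + 2 : ℕ) := by nlinarith
    have key := card_mul_le_sqrt hd v hv hγ.le (δ := 1 / 5) (by norm_num) hs (p / 2)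
      (le_mul_recurrence_coeff hd (by omega) hγ1 hxp.le hnx)
    have hD := choose_add_choose_mul_sqrt_le h (by exact_mod_cast hnp : 2 * p ≤ d + 2)
    rw [show d + 2 - 1 = d + 1 by omega] at hD
    exact ⟨by linarith, by linarith⟩

theorem theorem2p1 (γ : ℝ) (hγ : 0 < γ) (n : ℕ) (hn4 : 4 ≤ n)
    (hn : 2 * γ * (⌈(γ + 1) ^ 2⌉ : ℝ) ≤ (n : ℝ))
    (φ : ℝ) (hφ : Real.cos φ ≤ γ / Real.sqrt (n : ℝ)) :
    ∃ N : ℕ, maxSphericalCode n φ = (N : ℕ∞) ∧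
      (N : ℝ) ≤ ((n : ℝ) - 1) ^ (γ ^ 2 + 2 * γ + 3) / Real.Gamma (γ ^ 2 + 2 * γ + 2) := by
  set B : ℝ := ((n : ℝ) - 1) ^ (γ ^ 2 + 2 * γ + 3) / Real.Gamma (γ ^ 2 + 2 * γ + 2) with hB
  have hn4R : (4 : ℝ) ≤ n := by exact_mod_cast hn4
  have hB0 : 0 ≤ B := div_nonneg (Real.rpow_nonneg (by linarith) _)
    (Real.Gamma_pos_of_pos (by positivity)).le
  have hfin : ∀ Y : Set (EuclideanSpace ℝ (Fin n)), IsSphericalCode n φ Y → Y.Finite →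
      Y.encard ≤ (⌊B⌋₊ : ℕ∞) := by
    intro Y hY hYf
    have := hYf.fintype
    rw [Set.encard_eq_coe_toFinset_card, Set.toFinset_card]
    norm_cast
    rcases isEmpty_or_nonempty Y with h | h
    · simp
    refine Nat.le_floor (card_le_of_code hγ hn4 hn (fun a : Y => (a : EuclideanSpace ℝ (Fin n)).ofLp)
      (fun a => ?_) fun a b hab => ?_)
    · have := hY.1 a.2
      rw [mem_sphere_zero_iff_norm] at this
      rw [← EuclideanSpace.real_norm_sq_eq, this, one_pow]
    · have := (hY.2 a a.2 b b.2 (fun h => hab (Subtype.ext h))).trans hφ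
      rwa [EuclideanSpace.inner_eq_star_dotProduct, star_trivial, dotProduct_comm] at this
  -- an infinite code would contain finite codes of every size
  have hall : ∀ X : Set (EuclideanSpace ℝ (Fin n)), IsSphericalCode n φ X →
      X.encard ≤ (⌊B⌋₊ : ℕ∞) := by
    intro X hX
    by_contra! hlt
    obtain ⟨Y, hYX, hY⟩ := Set.exists_subset_encard_eq (Order.add_one_le_of_lt hlt)
    have hYc : IsSphericalCode n φ Y :=
      ⟨hYX.trans hX.1, fun x hx y hy => hX.2 x (hYX hx) y (hYX hy)⟩
    have hYf : Y.Finite := Set.finite_of_encard_eq_coe (k := ⌊B⌋₊ + 1) (by rw [hY]; norm_cast)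
    have := hfin Y hYc hYf
    rw [hY] at this
    exact absurd this (by norm_cast; omega)
  have hsup : maxSphericalCode n φ ≤ (⌊B⌋₊ : ℕ∞) := sSup_le fun m ⟨X, hX, hm⟩ => hm ▸ hall X hX
  obtain ⟨N, hN⟩ := ENat.ne_top_iff_exists.1 (ne_top_of_le_ne_top (ENat.natCast_ne_top _) hsup)
  refine ⟨N, hN.symm, ?_⟩
  rw [← hN, Nat.cast_le] at hsup
  exact (Nat.cast_le.2 hsup).trans (Nat.floor_le hB0)
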